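/- Let $\mathcal V$ be a set of Boolean variables. A trace over $X\subseteq\mathcal V$ is an infinite sequence in $(2^{X})^\omega$; $\pi\sqcup\rho$ is the position-wise union of two traces and $\pi{\downarrow_X}$ the position-wise intersection with $X$. An architecture with two processes $p,q$ is given by sets $I_p,I_q,O_p,O_q,O_e\subseteq\mathcal V$ such that $O_p,O_q,O_e$ are pairwise disjoint with union $\mathcal V$ (they may be empty), $I_p\cap O_p=I_q\cap O_q=\emptyset$, $I_p\subseteq O_q\cup O_e$ and $I_q\subseteq O_p\cup O_e$. A local specification of $p$ is an LTL formula $\varphi_p$ whose variables lie in $O_p\cup O_e$; its length $|\varphi_p|$ is the number of occurrences of atoms, constants and operators in it. Let $$\Delta_p=\{(\pi_e,\pi_e')\in(2^{O_e})^\omega\times(2^{O_e})^\omega \mid \forall \pi_p\in(2^{O_p})^\omega.\ \text{if } \pi_e\sqcup\pi_p\models\varphi_p \text{ then } \pi_e'\sqcup\pi_p\not\models\varphi_p\}.$$ The information flow assumption $\psi_p$ induced by $\varphi_p$ is the 2-hyperproperty given by the relation $$R=\{(\pi,\pi')\in(2^{\mathcal V})^\omega\times(2^{\mathcal V})^\omega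 \mid \text{if } (\pi{\downarrow_{O_e}},\pi'{\downarrow_{O_e}})\in\Delta_p \text{ then } \pi{\downarrow_{I_p}}\neq\pi'{\downarrow_{I_p}}\}.$$ A Büchi automaton (nondeterministic, with finitely many states and one initial state) over the alphabet $2^{\mathcal V}\times 2^{\mathcal V}$ recognizes $\psi_p$ if its language is $\{(\sigma_0,\sigma_0')(\sigma_1,\sigma_1')\dots \mid (\sigma_0\sigma_1\dots,\sigma_0'\sigma_1'\dots)\in R\}$. Theorem. There is an absolute constant $c\in\mathbb N$ such that, for every $\mathcal V$, every architecture over $\mathcal V$ and every local specification $\varphi_p$ of $p$, there is a Büchi automaton with at most $2^{c|\varphi_p|}$ states that recognizes $\psi_p$. Moreover, for a Büchi automaton $\mathcal A$ over the alphabet $2^{\mathcal V}$, let $\mathcal E(\mathcal A)$ be obtained as follows: self-compose $\mathcal A$ into an automaton that accepts a sequence of pairs iff both components are accepted by $\mathcal A$ and agree on $O_p$ at all positions; project out $O_p$, i.e. read only the values of $O_e$ and guess the values of $O_p$; and take the union with the two-state Büchi automaton that accepts a sequence of pairs iff its components differ at some position on $I_p$. Then $\mathcal E(\mathcal A)$ recognizes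 $\psi_p$ whenever $\mathcal A$ accepts exactly those traces over $O_e\cup O_p$ that satisfy $\varphi_p$ (with no requirement on other traces), and there is a Büchi automaton $\mathcal A$ that accepts exactly the traces over $\mathcal V$ satisfying $\varphi_p$ such that both $\mathcal A$ and $\mathcal E(\mathcal A)$ have at most $2^{c|\varphi_p|}$ states. -/

import Mathlib

/-! ### Traces -/

/-- A trace: an infinite sequence of valuations, a valuation being the set of the variables that
are true. -/
abbrev Trace (V : Type*) := ℕ → Set V

namespace Trace

variable {V : Type*}

/-- `π` is a trace over the set `X` of variables. -/
def IsOver (π : Trace V) (X : Set V) : Prop := ∀ i, π i ⊆ X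

/-- The combination of two traces: position-wise union of the valuations. -/
def combine (π ρ : Trace V) : Trace V := fun i => π i ∪ ρ i

/-- The projection of a trace onto a set of variables: position-wise intersection. -/
def proj (π : Trace V) (X : Set V) : Trace V := fun i => π i ∩ X

end Trace

/-! ### Linear-time temporal logic -/

/-- Formulas of propositional LTL with the elements of `V` as atomic propositions. -/
inductive LTL (V : Type*) where
  | verum : LTL V
  | falsum : LTL V
  | atom : V → LTL V
  | neg : LTL V → LTL V
  | and : LTL V → LTL V → LTL V
  | or : LTL V → LTL V → LTL V
  | imp : LTL V → LTL V → LTL V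
  | iff : LTL V → LTL V → LTL V
  | next : LTL V → LTL V
  | untl : LTL V → LTL V → LTL V
  | globally : LTL V → LTL V
  | eventually : LTL V → LTL V

namespace LTL

variable {V : Type*}

/-- `φ.SatAt π i`: the formula holds on the trace `π` at position `i`. -/
def SatAt (π : Trace V) : LTL V → ℕ → Prop
  | verum, _ => True
  | falsum, _ => False
  | atom v, i => v ∈ π i
  | neg φ, i => ¬ SatAt π φ i
  | and φ ψ, i => SatAt π φ i ∧ SatAt π ψ i
  | or φ ψ, i => SatAt π φ i ∨ SatAt π ψ i
  | imp φ ψ, i => SatAt π φ i → SatAt π ψ i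
  | iff φ ψ, i => (SatAt π φ i ↔ SatAt π ψ i)
  | next φ, i => SatAt π φ (i + 1)
  | untl φ ψ, i => ∃ j, i ≤ j ∧ SatAt π ψ j ∧ ∀ k, i ≤ k → k < j → SatAt π φ k
  | globally φ, i => ∀ j, i ≤ j → SatAt π φ j
  | eventually φ, i => ∃ j, i ≤ j ∧ SatAt π φ j

/-- The trace `π` satisfies the formula `φ`. -/
def Sat (π : Trace V) (φ : LTL V) : Prop := SatAt π φ 0

/-- The variables that occur in a formula. -/
def vars : LTL V → Set V
  | verum => ∅
  | falsum => ∅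
  | atom v => {v}
  | neg φ => vars φ
  | and φ ψ => vars φ ∪ vars ψ
  | or φ ψ => vars φ ∪ vars ψ
  | imp φ ψ => vars φ ∪ vars ψ
  | iff φ ψ => vars φ ∪ vars ψ
  | next φ => vars φ
  | untl φ ψ => vars φ ∪ vars ψ
  | globally φ => vars φ
  | eventually φ => vars φ

/-- The length of a formula: the number of occurrences of atoms, constants and operators. -/
def length : LTL V → ℕ
  | verum => 1
  | falsum => 1
  | atom _ => 1
  | neg φ => length φ + 1
  | and φ ψ => length φ + length ψ + 1
  | or φ ψ => length φ + length ψ + 1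
  | imp φ ψ => length φ + length ψ + 1
  | iff φ ψ => length φ + length ψ + 1
  | next φ => length φ + 1
  | untl φ ψ => length φ + length ψ + 1
  | globally φ => length φ + 1
  | eventually φ => length φ + 1

end LTL

/-! ### Architectures and the information flow assumption -/

/-- An architecture over the variables `V` with two black-box processes `p` and `q`: the sets of
input variables `Ip`, `Iq` and of output variables `Op`, `Oq` of the processes, and the set `Oe` of
output variables of the environment. -/
structure Architecture (V : Type*) where
  Ip : Set V
  Iq : Set V
  Op : Set V
  Oq : Set V
  Oe : Set V
  disjoint_Op_Oq : Disjoint Op Oq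
  disjoint_Op_Oe : Disjoint Op Oe
  disjoint_Oq_Oe : Disjoint Oq Oe
  cover : Op ∪ Oq ∪ Oe = Set.univ
  disjoint_Ip_Op : Disjoint Ip Op
  disjoint_Iq_Oq : Disjoint Iq Oq
  Ip_subset : Ip ⊆ Oq ∪ Oe
  Iq_subset : Iq ⊆ Op ∪ Oe

namespace Architecture

variable {V : Type*}

/-- `φ` can serve as local specification of process `p`: it refers only to the outputs of `p` and
of the environment. -/
def IsLocalSpec (S : Architecture V) (φ : LTL V) : Prop := φ.vars ⊆ S.Op ∪ S.Oe

/-- The distinguishability relation of process `p` for the local specification `φ`. -/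
def distinguishability (S : Architecture V) (φ : LTL V) : Set (Trace V × Trace V) :=
  {e | e.1.IsOver S.Oe ∧ e.2.IsOver S.Oe ∧
    ∀ o : Trace V, o.IsOver S.Op → φ.Sat (e.1.combine o) → ¬ φ.Sat (e.2.combine o)}

/-- The relation on traces that defines the information flow assumption of process `p` for the
local specification `φ`. -/
def infoFlowAssumption (S : Architecture V) (φ : LTL V) : Set (Trace V × Trace V) :=
  {t | (t.1.proj S.Oe, t.2.proj S.Oe) ∈ S.distinguishability φ →
    t.1.proj S.Ip ≠ t.2.proj S.Ip}

end Architecture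

/-- A relation on infinite sequences over `α`, represented as a set of infinite sequences over the
product alphabet `α × α`. -/
def pairWords {α : Type*} (R : Set ((ℕ → α) × (ℕ → α))) : Set (ℕ → α × α) :=
  {w | (fun i => (w i).1, fun i => (w i).2) ∈ R}

/-! ### Büchi automata -/

/-- A nondeterministic Büchi automaton over the alphabet `α` with set of states `σ` (to be used
with `[Fintype σ]`) and one designated initial state. -/
structure BuchiAutomaton (α : Type*) (σ : Type*) where
  init : σ
  accept : Set σ
  step : σ → α → Set σ

namespace BuchiAutomaton

variable {α V σ τ : Type*}

/-- `r` is a run of `M` on the infinite word `w`. -/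
def IsRun (M : BuchiAutomaton α σ) (w : ℕ → α) (r : ℕ → σ) : Prop :=
  r 0 = M.init ∧ ∀ i, r (i + 1) ∈ M.step (r i) (w i)

/-- The set of the infinite words on which `M` has a run that visits accepting states infinitely
often. -/
def language (M : BuchiAutomaton α σ) : Set (ℕ → α) :=
  {w | ∃ r, M.IsRun w r ∧ {i | r i ∈ M.accept}.Infinite}

/-- The self-composition of `M`: both components of a word of pairs have to be accepted by `M` and
have to agree on the variables in `O` at all positions. The Boolean component of a state says which
copy of `M` is to visit an accepting state next (`false`: the first, `true`: the second). -/
def selfComp (M : BuchiAutomaton (Set V) σ) (O : Set V) :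
    BuchiAutomaton (Set V × Set V) (σ × σ × Bool) where
  init := (M.init, M.init, false)
  accept := {s | s.2.1 ∈ M.accept ∧ s.2.2 = true}
  step s x := {s' | x.1 ∩ O = x.2 ∩ O ∧ s'.1 ∈ M.step s.1 x.1 ∧ s'.2.1 ∈ M.step s.2.1 x.2 ∧
    (s.2.2 = false → (s'.2.2 = true ↔ s.1 ∈ M.accept)) ∧
    (s.2.2 = true → (s'.2.2 = false ↔ s.2.1 ∈ M.accept))}

/-- Projecting out the variables in `O`: the automaton reads only the variables in `E` and guesses
a (common) valuation of the variables in `O`. -/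
def projectOut (M : BuchiAutomaton (Set V × Set V) σ) (E O : Set V) :
    BuchiAutomaton (Set V × Set V) σ where
  init := M.init
  accept := M.accept
  step s x := {s' | ∃ o ⊆ O, s' ∈ M.step s ((x.1 ∩ E) ∪ o, (x.2 ∩ E) ∪ o)}

/-- The two-state automaton that accepts a sequence of pairs iff its components differ at some
position on the variables in `I`. -/
def inputsDiffer (I : Set V) : BuchiAutomaton (Set V × Set V) Bool where
  init := false
  accept := {true}
  step s x := {s' | s' = true ↔ s = true ∨ x.1 ∩ I ≠ x.2 ∩ I}

/-- The union of two automata: their disjoint union with a fresh initial state `none` that has the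
outgoing transitions of both initial states. -/
def union (M : BuchiAutomaton α σ) (N : BuchiAutomaton α τ) :
    BuchiAutomaton α (Option (σ ⊕ τ)) where
  init := none
  accept := {s | (∃ q ∈ M.accept, s = some (.inl q)) ∨ ∃ q ∈ N.accept, s = some (.inr q)}
  step s x :=
    match s with
    | none => {s' | (∃ q ∈ M.step M.init x, s' = some (.inl q)) ∨
        ∃ q ∈ N.step N.init x, s' = some (.inr q)}
    | some (.inl q) => {s' | ∃ q' ∈ M.step q x, s' = some (.inl q')}
    | some (.inr q) => {s' | ∃ q' ∈ N.step q x, s' = some (.inr q')}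

/-- From an automaton `M` for a local specification of process `p`: self-compose `M` with agreement
on `Op`, project out `Op`, and form the union with the automaton that checks that the inputs `Ip`
differ. -/
def infoFlow (S : Architecture V) (M : BuchiAutomaton (Set V) σ) :
    BuchiAutomaton (Set V × Set V) (Option ((σ × σ × Bool) ⊕ Bool)) :=
  ((M.selfComp S.Op).projectOut S.Oe S.Op).union (inputsDiffer S.Ip)

end BuchiAutomaton

/-!
The automaton for `φ` is composed from *testers*, one for each operator of `φ`. A tester for a
property of positions is a transition system without initial states that has a fair run on every
word, and whose fair runs all announce, at each position, whether the property holds there. Boolean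
operators cost no new states, since they only combine announcements; `next` and `untl` each add one
guessed bit. The bit `b` of an until is constrained by the expansion law
`b i ↔ Q i ∨ (P i ∧ b (i + 1))`; this law determines `b` up to the choice between least and greatest
fixed point, and the fairness condition "infinitely often `¬ b` or `Q`" selects the least one
(`until_iff_of_expansion`). Hence a formula of length `n` has a tester with at most `2 ^ n` states
and `n` fairness conditions (`LTL.hasTester`).

The fairness conditions are merged into a single Büchi condition by recording which of them are
still to be met since the last breakpoint (`infinite_breakpoint_iff`), which multiplies the number
of states by `2 ^ n`; a fresh initial state requires that the tester announces `φ` at position `0`.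

Two projected traces are not in the distinguishability relation iff some common output of the
process makes both of them satisfy `φ`. This is what self-composition followed by projection checks
(`BuchiAutomaton.mem_language_selfComp`, `BuchiAutomaton.mem_language_projectOut`), and only the
behaviour on traces over the outputs of the environment and of the process matters for it
(`BuchiAutomaton.language_infoFlow`). For `N` states of the automaton for `φ` the resulting automaton
has `2 * N ^ 2 + 3` states, so the bound remains `2 ^ O(n)`.
-/

/-! ### Events that occur infinitely often -/

theorem infinite_iff_forall_exists_ge {A : Set ℕ} : A.Infinite ↔ ∀ N, ∃ i, N ≤ i ∧ i ∈ A := by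
  rw [← Filter.frequently_atTop]
  exact Nat.frequently_atTop_iff_infinite.symm

theorem infinite_succ_iff {p : ℕ → Prop} : {i | p (i + 1)}.Infinite ↔ {i | p i}.Infinite := by
  simp only [infinite_iff_forall_exists_ge, Set.mem_ofPred_eq]
  constructor
  · intro h N
    obtain ⟨i, hi, hp⟩ := h N
    exact ⟨i + 1, by omega, hp⟩
  · intro h N
    obtain ⟨i, hi, hp⟩ := h (N + 1)
    obtain ⟨k, rfl⟩ : ∃ k, i = k + 1 := ⟨i - 1, by omega⟩
    exact ⟨k, by omega, hp⟩

/-- Breakpoint construction: let `B` hold the indices whose event has not occurred since `B` was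
last empty, being refilled whenever it is empty. Then `B` is empty infinitely often iff all the
events occur infinitely often. -/
theorem infinite_breakpoint_iff {ι : Type*} [Finite ι] {p : ι → ℕ → Prop} {B : ℕ → Set ι}
    (hB : ∀ i j, j ∈ B (i + 1) ↔ (B i = ∅ ∨ j ∈ B i) ∧ ¬ p j i) :
    {i | B i = ∅}.Infinite ↔ ∀ j, {i | p j i}.Infinite := by
  simp only [infinite_iff_forall_exists_ge, Set.mem_ofPred_eq]
  constructor
  · intro h j N
    obtain ⟨n, hn, hBn⟩ := h N
    obtain ⟨m, hm, hBm⟩ := h (n + 1)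
    by_contra! hp
    have key : ∀ d, j ∈ B (n + 1 + d) := by
      intro d
      induction d with
      | zero => exact (hB n j).2 ⟨Or.inl hBn, hp n hn⟩
      | succ d ih => exact (hB (n + 1 + d) j).2 ⟨Or.inr ih, hp _ (by omega)⟩
    have := key (m - (n + 1))
    rw [show n + 1 + (m - (n + 1)) = m by omega, hBm] at this
    exact this
  · intro h N
    by_contra! hne
    choose t ht hpt using fun j => h j N
    have gone : ∀ j d, j ∉ B (t j + 1 + d) := by
      intro j d
      induction d with
      | zero => exact fun hj => ((hB _ j).1 hj).2 (hpt j)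
      | succ d ih =>
        intro hj
        rcases ((hB (t j + 1 + d) j).1 hj).1 with h0 | h0
        · exact (hne _ (by have := ht j; omega)).ne_empty h0
        · exact ih h0
    obtain ⟨T, hT⟩ := (Set.finite_range t).bddAbove
    obtain ⟨j, hj⟩ := hne (N + T + 1) (by omega)
    have hle : t j ≤ T := hT ⟨j, rfl⟩
    have := gone j (N + T - t j)
    rw [show t j + 1 + (N + T - t j) = N + T + 1 by omega] at this
    exact this hj

/-- Two events occur infinitely often iff they can be met alternatingly, where the flag `c` tells
which of them is awaited next. -/
theorem infinite_flag_iff {p q : ℕ → Prop} {c : ℕ → Bool}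
    (h0 : ∀ i, c i = false → (c (i + 1) = true ↔ p i))
    (h1 : ∀ i, c i = true → (c (i + 1) = false ↔ q i)) :
    {i | q i ∧ c i = true}.Infinite ↔ {i | p i}.Infinite ∧ {i | q i}.Infinite := by
  constructor
  · refine fun h => ⟨?_, h.mono fun i hi => hi.1⟩
    rw [infinite_iff_forall_exists_ge] at h ⊢
    intro N
    obtain ⟨n, hn, hq, hc⟩ := h N
    obtain ⟨m, hm, -, hcm⟩ := h (n + 1)
    by_contra! hp
    have key : ∀ d, c (n + 1 + d) = false := by
      intro d
      induction d with
      | zero => exact (h1 n hc).2 hq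
      | succ d ih =>
        have := (h0 _ ih).not.2 (hp (n + 1 + d) (by omega))
        simpa [add_assoc] using this
    have := key (m - (n + 1))
    rw [show n + 1 + (m - (n + 1)) = m by omega, hcm] at this
    exact absurd this (by decide)
  · rintro ⟨hp, hq⟩
    rw [infinite_iff_forall_exists_ge] at hp hq ⊢
    intro N
    obtain ⟨n, hn, hcn⟩ : ∃ n, N ≤ n ∧ c n = true := by
      obtain ⟨k, hk, hpk⟩ := hp N
      rcases hck : c k with _ | _
      · exact ⟨k + 1, by omega, (h0 k hck).2 hpk⟩
      · exact ⟨k, hk, hck⟩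
    by_contra! hno
    have key : ∀ d, c (n + d) = true := by
      intro d
      induction d with
      | zero => exact hcn
      | succ d ih =>
        have hnq : ¬ q (n + d) := fun h => hno (n + d) (by omega) ⟨h, ih⟩
        have := (h1 _ ih).not.2 hnq
        simpa [add_assoc] using this
    obtain ⟨m, hm, hqm⟩ := hq n
    refine hno m (by omega) ⟨hqm, ?_⟩
    have := key (m - n)
    rwa [show n + (m - n) = m by omega] at this

/-! ### Testers -/

/-- Whether `Q` holds at some position from `i` on, with `P` holding at all positions before. -/
def UntilAt (P Q : ℕ → Prop) (i : ℕ) : Prop :=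
  ∃ j, i ≤ j ∧ Q j ∧ ∀ k, i ≤ k → k < j → P k

theorem untilAt_expansion (P Q : ℕ → Prop) (i : ℕ) :
    UntilAt P Q i ↔ Q i ∨ (P i ∧ UntilAt P Q (i + 1)) := by
  constructor
  · rintro ⟨j, hij, hQ, hP⟩
    rcases hij.eq_or_lt with rfl | hlt
    · exact Or.inl hQ
    · exact Or.inr ⟨hP i le_rfl hlt, j, hlt, hQ, fun k hk => hP k (by omega)⟩
  · rintro (hQ | ⟨hP, j, hj, hQ, h⟩)
    · exact ⟨i, le_rfl, hQ, fun k h1 h2 => by omega⟩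
    · refine ⟨j, by omega, hQ, fun k h1 h2 => ?_⟩
      rcases h1.eq_or_lt with rfl | h3
      · exact hP
      · exact h k h3 h2

/-- The until is the only solution of the expansion law that does not eventually promise `Q`
forever without delivering it. -/
theorem until_iff_of_expansion {P Q b : ℕ → Prop} (hb : ∀ i, b i ↔ Q i ∨ (P i ∧ b (i + 1)))
    (hf : {i | b i → Q i}.Infinite) (i : ℕ) : b i ↔ UntilAt P Q i := by
  constructor
  · intro hbi
    rw [infinite_iff_forall_exists_ge] at hf
    obtain ⟨k, hk, hbk⟩ := hf i
    obtain ⟨d, rfl⟩ := Nat.exists_eq_add_of_le hk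
    clear hk
    induction d generalizing i with
    | zero => exact (untilAt_expansion P Q i).2 (Or.inl (hbk hbi))
    | succ d ih =>
      rw [untilAt_expansion]
      rcases (hb i).1 hbi with h | ⟨h, h'⟩
      · exact Or.inl h
      · refine Or.inr ⟨h, ih (i + 1) h' ?_⟩
        rwa [show i + 1 + d = i + (d + 1) by omega]
  · rintro ⟨j, hij, hQ, hP⟩
    obtain ⟨d, rfl⟩ := Nat.exists_eq_add_of_le hij
    clear hij
    induction d generalizing i with
    | zero => exact (hb i).2 (Or.inl hQ)
    | succ d ih =>
      refine (hb i).2 (Or.inr ⟨hP i le_rfl (by omega), ih (i + 1) ?_ ?_⟩)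
      · rwa [show i + 1 + d = i + (d + 1) by omega]
      · exact fun k h1 h2 => hP k (by omega) (by omega)

/-- A transition system over the alphabet `α` with states `σ`, a fairness condition for each element
of `ι` and an announcement in each state (`out` is the set of the states that announce "true").
There are no initial states: a run may start anywhere. -/
structure Tester (α σ ι : Type*) where
  step : σ → α → Set σ
  fair : ι → Set σ
  out : Set σ

namespace Tester

variable {α σ ι : Type*}

/-- `r` follows the transitions on the word `w` and meets each fairness condition infinitely
often. -/
def IsFairRun (T : Tester α σ ι) (w : ℕ → α) (r : ℕ → σ) : Prop :=
  (∀ i, r (i + 1) ∈ T.step (r i) (w i)) ∧ ∀ j, {i | r i ∈ T.fair j}.Infinite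

/-- All fair runs on a word announce at each position whether `P` holds there, and there is a fair
run on every word. -/
def Tests (T : Tester α σ ι) (P : (ℕ → α) → ℕ → Prop) : Prop :=
  (∀ w r, T.IsFairRun w r → ∀ i, r i ∈ T.out ↔ P w i) ∧ ∀ w, ∃ r, T.IsFairRun w r

end Tester

/-- `P` has a tester with at most `2 ^ m` states and at most `m` fairness conditions. -/
def HasTester {α : Type*} (P : (ℕ → α) → ℕ → Prop) (m : ℕ) : Prop :=
  ∃ (σ : Type) (_ : Fintype σ) (ι : Type) (_ : Fintype ι) (T : Tester α σ ι),
    T.Tests P ∧ Fintype.card σ ≤ 2 ^ m ∧ Fintype.card ι ≤ m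

namespace HasTester

variable {α : Type*} {P Q : (ℕ → α) → ℕ → Prop} {m n : ℕ}

theorem mono (h : HasTester P m) (hmn : m ≤ n) : HasTester P n := by
  obtain ⟨σ, _, ι, _, T, hT, hσ, hι⟩ := h
  exact ⟨σ, _, ι, _, T, hT, hσ.trans (Nat.pow_le_pow_right two_pos hmn), hι.trans hmn⟩

theorem const (a : Prop) : HasTester (fun (_ : ℕ → α) _ => a) 0 :=
  ⟨Unit, inferInstance, Empty, inferInstance, ⟨fun _ _ => Set.univ, fun _ => ∅, {_s | a}⟩,
    ⟨fun _ _ _ _ => Iff.rfl, fun _ => ⟨fun _ => (), fun _ => trivial, fun j => j.elim⟩⟩,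
    by simp, by simp⟩

/-- The tester guesses whether the next letter is in `A`. -/
theorem letter (A : Set α) : HasTester (fun w i => w i ∈ A) 1 := by
  classical
  refine ⟨Bool, inferInstance, Empty, inferInstance,
    ⟨fun s x => {_s' | s = true ↔ x ∈ A}, fun _ => ∅, {true}⟩, ⟨?_, ?_⟩, by simp, by simp⟩
  · intro w r hr i
    exact hr.1 i
  · intro w
    exact ⟨fun i => decide (w i ∈ A), fun i => decide_eq_true_iff, fun j => j.elim⟩

/-- The testers for `P` and `Q` run in parallel; their announcements are combined by `f`. -/
theorem map₂ (hP : HasTester P m) (hQ : HasTester Q n) (f : Prop → Prop → Prop) :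
    HasTester (fun w i => f (P w i) (Q w i)) (m + n) := by
  obtain ⟨σ, _, ι, _, T, ⟨hT, hT'⟩, hσ, hι⟩ := hP
  obtain ⟨τ, _, κ, _, U, ⟨hU, hU'⟩, hτ, hκ⟩ := hQ
  refine ⟨σ × τ, inferInstance, ι ⊕ κ, inferInstance,
    ⟨fun s x => T.step s.1 x ×ˢ U.step s.2 x,
      Sum.elim (fun j => {s | s.1 ∈ T.fair j}) (fun j => {s | s.2 ∈ U.fair j}),
      {s | f (s.1 ∈ T.out) (s.2 ∈ U.out)}⟩, ⟨?_, ?_⟩, ?_, ?_⟩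
  · intro w r hr i
    have h1 := hT w (fun i => (r i).1) ⟨fun i => (hr.1 i).1, fun j => hr.2 (.inl j)⟩ i
    have h2 := hU w (fun i => (r i).2) ⟨fun i => (hr.1 i).2, fun j => hr.2 (.inr j)⟩ i
    simp only [Set.mem_ofPred_eq, h1, h2]
  · intro w
    obtain ⟨r, hr⟩ := hT' w
    obtain ⟨s, hs⟩ := hU' w
    refine ⟨fun i => (r i, s i), fun i => ⟨hr.1 i, hs.1 i⟩, ?_⟩
    rintro (j | j)
    · exact hr.2 j
    · exact hs.2 j
  · rw [Fintype.card_prod, pow_add]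
    exact Nat.mul_le_mul hσ hτ
  · rw [Fintype.card_sum]
    exact Nat.add_le_add hι hκ

theorem map (hP : HasTester P m) (f : Prop → Prop) : HasTester (fun w i => f (P w i)) m :=
  hP.map₂ (const True) fun a _ => f a

/-- The additional bit guesses the announcement of the tester for `P` in the next state. -/
theorem next (hP : HasTester P m) : HasTester (fun w i => P w (i + 1)) (m + 1) := by
  classical
  obtain ⟨σ, _, ι, _, T, ⟨hT, hT'⟩, hσ, hι⟩ := hP
  refine ⟨σ × Bool, inferInstance, ι, inferInstance,
    ⟨fun s x => {s' | s'.1 ∈ T.step s.1 x ∧ (s.2 = true ↔ s'.1 ∈ T.out)},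
      fun j => {s | s.1 ∈ T.fair j}, {s | s.2 = true}⟩, ⟨?_, ?_⟩, ?_, by omega⟩
  · intro w r hr i
    have h1 := hT w (fun i => (r i).1) ⟨fun i => (hr.1 i).1, hr.2⟩ (i + 1)
    exact (hr.1 i).2.trans h1
  · intro w
    obtain ⟨r, hr⟩ := hT' w
    exact ⟨fun i => (r i, decide (r (i + 1) ∈ T.out)), fun i => ⟨hr.1 i, by simp⟩, hr.2⟩
  · rw [Fintype.card_prod, Fintype.card_bool, pow_succ]
    exact Nat.mul_le_mul_right 2 hσ

/-- The additional bit guesses the truth value of the until and is checked by the expansion law; the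
additional fairness condition excludes promises that are never kept. -/
theorem untl (hP : HasTester P m) (hQ : HasTester Q n) :
    HasTester (fun w i => UntilAt (P w) (Q w) i) (m + n + 1) := by
  classical
  obtain ⟨σ, _, ι, _, T, ⟨hT, hT'⟩, hσ, hι⟩ := hP
  obtain ⟨τ, _, κ, _, U, ⟨hU, hU'⟩, hτ, hκ⟩ := hQ
  refine ⟨(σ × τ) × Bool, inferInstance, Option (ι ⊕ κ), inferInstance,
    ⟨fun s x => {s' | s'.1.1 ∈ T.step s.1.1 x ∧ s'.1.2 ∈ U.step s.1.2 x ∧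
        (s.2 = true ↔ s.1.2 ∈ U.out ∨ (s.1.1 ∈ T.out ∧ s'.2 = true))},
      fun j => j.elim {s | s.2 = true → s.1.2 ∈ U.out}
        (Sum.elim (fun j => {s | s.1.1 ∈ T.fair j}) (fun j => {s | s.1.2 ∈ U.fair j})),
      {s | s.2 = true}⟩, ⟨?_, ?_⟩, ?_, ?_⟩
  · intro w r hr i
    have h1 := hT w (fun i => (r i).1.1)
      ⟨fun i => (hr.1 i).1, fun j => hr.2 (some (.inl j))⟩
    have h2 := hU w (fun i => (r i).1.2)
      ⟨fun i => (hr.1 i).2.1, fun j => hr.2 (some (.inr j))⟩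
    refine until_iff_of_expansion (b := fun i => (r i).2 = true) (fun i => ?_) ?_ i
    · rw [← h1, ← h2]
      exact (hr.1 i).2.2
    · exact (hr.2 none).mono fun i (hi : (r i).2 = true → (r i).1.2 ∈ U.out) hb => (h2 i).1 (hi hb)
  · intro w
    obtain ⟨r, hr⟩ := hT' w
    obtain ⟨s, hs⟩ := hU' w
    have h1 := hT w r hr
    have h2 := hU w s hs
    refine ⟨fun i => ((r i, s i), decide (UntilAt (P w) (Q w) i)),
      fun i => ⟨hr.1 i, hs.1 i, ?_⟩, ?_⟩
    · simp only [decide_eq_true_eq, h1, h2]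
      exact untilAt_expansion _ _ i
    · rintro (_ | j | j)
      · rw [infinite_iff_forall_exists_ge]
        intro N
        simp only [Option.elim, Set.mem_ofPred_eq, decide_eq_true_eq, h2]
        by_cases hN : UntilAt (P w) (Q w) N
        · obtain ⟨k, hk, hQ, -⟩ := hN
          exact ⟨k, hk, fun _ => hQ⟩
        · exact ⟨N, le_rfl, fun h => absurd h hN⟩
      · exact hr.2 j
      · exact hs.2 j
  · rw [Fintype.card_prod, Fintype.card_prod, Fintype.card_bool, pow_succ, pow_add]
    exact Nat.mul_le_mul_right 2 (Nat.mul_le_mul hσ hτ)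
  · rw [Fintype.card_option, Fintype.card_sum]
    omega

end HasTester

theorem LTL.hasTester {V : Type*} (φ : LTL V) :
    HasTester (fun π i => SatAt π φ i) φ.length := by
  induction φ with
  | verum => exact (HasTester.const True).mono (Nat.zero_le _)
  | falsum => exact (HasTester.const False).mono (Nat.zero_le _)
  | atom v => exact HasTester.letter {x | v ∈ x}
  | neg φ ih => exact (ih.map Not).mono (Nat.le_succ _)
  | and φ ψ ih₁ ih₂ => exact (ih₁.map₂ ih₂ And).mono (Nat.le_succ _)
  | or φ ψ ih₁ ih₂ => exact (ih₁.map₂ ih₂ Or).mono (Nat.le_succ _)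
  | imp φ ψ ih₁ ih₂ => exact (ih₁.map₂ ih₂ fun a b => a → b).mono (Nat.le_succ _)
  | iff φ ψ ih₁ ih₂ => exact (ih₁.map₂ ih₂ Iff).mono (Nat.le_succ _)
  | next φ ih => exact ih.next
  | untl φ ψ ih₁ ih₂ => exact ih₁.untl ih₂
  | globally φ ih =>
    have h := (((HasTester.const True).untl (ih.map Not)).map Not).mono
      (show 0 + φ.length + 1 ≤ φ.globally.length by simp [length])
    convert h using 3
    simp [UntilAt, SatAt]
  | eventually φ ih =>
    have h := ((HasTester.const True).untl ih).mono
      (show 0 + φ.length + 1 ≤ φ.eventually.length by simp [length])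
    convert h using 3
    simp [UntilAt, SatAt]

/-! ### From testers to Büchi automata -/

namespace Tester

variable {α σ ι : Type*}

/-- The Büchi automaton that accepts a word iff the tester has a fair run on it that announces
"true" at position `0`. The second component of a state holds the fairness conditions still to be
met before the next breakpoint; the breakpoints, where it is empty, are the accepting states. -/
def toBuchi (T : Tester α σ ι) : BuchiAutomaton α (Option (σ × Set ι)) where
  init := none
  accept := {s | ∃ q, s = some (q, ∅)}
  step s x :=
    match s with
    | none => {s' | ∃ q ∈ T.out, ∃ q' ∈ T.step q x, s' = some (q', ∅)}
    | some (q, B) => {s' | ∃ q' ∈ T.step q x,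
        s' = some (q', {j | (B = ∅ ∨ j ∈ B) ∧ q ∉ T.fair j})}

theorem mem_language_toBuchi [Finite ι] {T : Tester α σ ι} {P : (ℕ → α) → ℕ → Prop}
    (hT : T.Tests P) (w : ℕ → α) : w ∈ T.toBuchi.language ↔ P w 0 := by
  constructor
  · rintro ⟨r, ⟨hr0, hr⟩, hacc⟩
    obtain ⟨q₀, hq₀, q₁, hq₁, hr1⟩ : ∃ q ∈ T.out, ∃ q' ∈ T.step q (w 0), r 1 = some (q', ∅) := by
      have := hr 0
      rw [hr0] at this
      exact this
    have hsome : ∀ i, ∃ s : σ × Set ι, r (i + 1) = some s := by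
      intro i
      induction i with
      | zero => exact ⟨_, hr1⟩
      | succ i ih =>
        obtain ⟨⟨q, B⟩, hq⟩ := ih
        have := hr (i + 1)
        rw [hq] at this
        obtain ⟨q', -, h⟩ := this
        exact ⟨_, h⟩
    choose s hs using hsome
    have hstep : ∀ i, (s (i + 1)).1 ∈ T.step (s i).1 (w (i + 1)) ∧
        (s (i + 1)).2 = {j | ((s i).2 = ∅ ∨ j ∈ (s i).2) ∧ (s i).1 ∉ T.fair j} := by
      intro i
      have := hr (i + 1)
      rw [hs i, hs (i + 1)] at this
      obtain ⟨q', hq', h⟩ := this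
      rw [Option.some.inj h]
      exact ⟨hq', rfl⟩
    have hs0 : (s 0).1 = q₁ := by
      rw [hs 0] at hr1
      rw [Option.some.inj hr1]
    have hinf : {i | (s i).2 = ∅}.Infinite := by
      refine (infinite_succ_iff.2 hacc).mono ?_
      rintro i ⟨q, hq⟩
      rw [hs i] at hq
      change (s i).2 = ∅
      rw [Option.some.inj hq]
    rw [infinite_breakpoint_iff (p := fun j i => (s i).1 ∈ T.fair j)
      fun i j => by rw [(hstep i).2]; rfl] at hinf
    let r' : ℕ → σ := fun i => i.casesOn q₀ fun i => (s i).1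
    have hr' : T.IsFairRun w r' := by
      refine ⟨?_, fun j => infinite_succ_iff.1 (hinf j)⟩
      rintro (_ | i)
      · change (s 0).1 ∈ T.step q₀ (w 0)
        rwa [hs0]
      · exact (hstep i).1
    exact (hT.1 w r' hr' 0).1 hq₀
  · intro hP
    obtain ⟨r, hr⟩ := hT.2 w
    let B : ℕ → Set ι := fun i =>
      i.rec ∅ fun i B => {j | (B = ∅ ∨ j ∈ B) ∧ r (i + 1) ∉ T.fair j}
    refine ⟨fun i => i.casesOn none fun i => some (r (i + 1), B i), ⟨rfl, ?_⟩, ?_⟩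
    · rintro (_ | i)
      · exact ⟨r 0, (hT.1 w r hr 0).2 hP, r 1, hr.1 0, rfl⟩
      · exact ⟨r (i + 2), hr.1 (i + 1), rfl⟩
    · have hB : {i | B i = ∅}.Infinite :=
        (infinite_breakpoint_iff (p := fun j i => r (i + 1) ∈ T.fair j) fun i j => Iff.rfl).2
          fun j => infinite_succ_iff.2 (hr.2 j)
      rw [← infinite_succ_iff]
      refine hB.mono fun i hi => ⟨r (i + 1), ?_⟩
      change some (r (i + 1), B i) = _
      rw [show B i = ∅ from hi]

end Tester

/-- Every LTL formula `φ` is recognized by a Büchi automaton with exponentially many states. -/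
theorem LTL.exists_buchi {V : Type*} (φ : LTL V) :
    ∃ (σ : Type) (_ : Fintype σ) (M : BuchiAutomaton (Set V) σ),
      M.language = {π | φ.Sat π} ∧ Fintype.card σ ≤ 2 ^ (2 * φ.length) + 1 := by
  classical
  obtain ⟨σ, _, ι, _, T, hT, hσ, hι⟩ := φ.hasTester
  refine ⟨Option (σ × Set ι), inferInstance, T.toBuchi, ?_, ?_⟩
  · ext π
    exact T.mem_language_toBuchi hT π
  · rw [Fintype.card_option, Fintype.card_prod, Fintype.card_set, two_mul, pow_add]
    exact Nat.succ_le_succ (Nat.mul_le_mul hσ (Nat.pow_le_pow_right two_pos hι))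

/-! ### The languages of the constructions -/

namespace BuchiAutomaton

variable {α V σ τ : Type*}

theorem mem_language_selfComp (M : BuchiAutomaton (Set V) σ) (O : Set V)
    (w : ℕ → Set V × Set V) :
    w ∈ (M.selfComp O).language ↔ (fun i => (w i).1) ∈ M.language ∧
      (fun i => (w i).2) ∈ M.language ∧ ∀ i, (w i).1 ∩ O = (w i).2 ∩ O := by
  classical
  constructor
  · rintro ⟨r, ⟨hr0, hr⟩, hacc⟩
    obtain ⟨h1, h2⟩ := (infinite_flag_iff (p := fun i => (r i).1 ∈ M.accept)
      (q := fun i => (r i).2.1 ∈ M.accept) (c := fun i => (r i).2.2)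
      (fun i => (hr i).2.2.2.1) (fun i => (hr i).2.2.2.2)).1 hacc
    exact ⟨⟨fun i => (r i).1, ⟨by simp only [hr0]; rfl, fun i => (hr i).2.1⟩, h1⟩,
      ⟨fun i => (r i).2.1, ⟨by simp only [hr0]; rfl, fun i => (hr i).2.2.1⟩, h2⟩,
      fun i => (hr i).1⟩
  · rintro ⟨⟨r, ⟨hr0, hr⟩, hracc⟩, ⟨s, ⟨hs0, hs⟩, hsacc⟩, hO⟩
    let c : ℕ → Bool := fun i => i.rec false fun i b =>
      bif b then decide (s i ∉ M.accept) else decide (r i ∈ M.accept)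
    have hc : ∀ i, c (i + 1) =
        bif c i then decide (s i ∉ M.accept) else decide (r i ∈ M.accept) := fun _ => rfl
    have h0 : ∀ i, c i = false → (c (i + 1) = true ↔ r i ∈ M.accept) := by
      intro i hi
      simp [hc, hi]
    have h1 : ∀ i, c i = true → (c (i + 1) = false ↔ s i ∈ M.accept) := by
      intro i hi
      simp [hc, hi]
    refine ⟨fun i => (r i, s i, c i), ⟨?_, fun i => ⟨hO i, hr i, hs i, h0 i, h1 i⟩⟩, ?_⟩
    · change (r 0, s 0, false) = (M.init, M.init, false)
      rw [hr0, hs0]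
    · exact (infinite_flag_iff h0 h1).2 ⟨hracc, hsacc⟩

theorem mem_language_projectOut (M : BuchiAutomaton (Set V × Set V) σ) (E O : Set V)
    (w : ℕ → Set V × Set V) :
    w ∈ (M.projectOut E O).language ↔ ∃ o : Trace V, o.IsOver O ∧
      (fun i => (((w i).1 ∩ E) ∪ o i, ((w i).2 ∩ E) ∪ o i)) ∈ M.language := by
  constructor
  · rintro ⟨r, ⟨hr0, hr⟩, hacc⟩
    choose o ho hstep using hr
    exact ⟨o, ho, r, ⟨hr0, hstep⟩, hacc⟩
  · rintro ⟨o, ho, r, ⟨hr0, hstep⟩, hacc⟩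
    exact ⟨r, ⟨hr0, fun i => ⟨o i, ho i, hstep i⟩⟩, hacc⟩

theorem mem_language_inputsDiffer (I : Set V) (w : ℕ → Set V × Set V) :
    w ∈ (inputsDiffer I).language ↔ ∃ i, (w i).1 ∩ I ≠ (w i).2 ∩ I := by
  classical
  constructor
  · rintro ⟨r, ⟨hr0, hr⟩, hacc⟩
    by_contra! hno
    have key : ∀ i, r i ≠ true := by
      intro i
      induction i with
      | zero => rw [hr0]; exact Bool.false_ne_true
      | succ i ih =>
        intro h
        rcases (hr i).1 h with h | h
        · exact ih h
        · exact h (hno i)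
    obtain ⟨i, hi⟩ := hacc.nonempty
    exact key i hi
  · rintro ⟨n, hn⟩
    refine ⟨fun i => decide (∃ k < i, (w k).1 ∩ I ≠ (w k).2 ∩ I), ⟨by simp [inputsDiffer], ?_⟩, ?_⟩
    · intro i
      change decide _ = true ↔ decide _ = true ∨ _
      simp only [decide_eq_true_eq, Nat.lt_succ_iff_lt_or_eq]
      constructor
      · rintro ⟨k, hk | rfl, h⟩
        · exact Or.inl ⟨k, hk, h⟩
        · exact Or.inr h
      · rintro (⟨k, hk, h⟩ | h)
        · exact ⟨k, Or.inl hk, h⟩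
        · exact ⟨i, Or.inr rfl, h⟩
    · rw [infinite_iff_forall_exists_ge]
      exact fun N => ⟨N + n + 1, by omega, decide_eq_true ⟨n, by omega, hn⟩⟩

theorem mem_language_union (M : BuchiAutomaton α σ) (N : BuchiAutomaton α τ) (w : ℕ → α) :
    w ∈ (M.union N).language ↔ w ∈ M.language ∨ w ∈ N.language := by
  constructor
  · rintro ⟨r, ⟨hr0, hr⟩, hacc⟩
    have h1 := hr 0
    rw [hr0] at h1
    have hacc' := infinite_succ_iff.2 hacc
    rcases h1 with ⟨q, hq, hrq⟩ | ⟨q, hq, hrq⟩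
    · left
      have hsome : ∀ i, ∃ s, r (i + 1) = some (.inl s) := by
        intro i
        induction i with
        | zero => exact ⟨q, hrq⟩
        | succ i ih =>
          obtain ⟨s, hs⟩ := ih
          have := hr (i + 1)
          rw [hs] at this
          obtain ⟨s', -, h⟩ := this
          exact ⟨s', h⟩
      choose s hs using hsome
      refine ⟨fun i => i.casesOn M.init s, ⟨rfl, ?_⟩, ?_⟩
      · rintro (_ | i)
        · rw [hs 0] at hrq
          change s 0 ∈ M.step M.init (w 0)
          rwa [Sum.inl.inj (Option.some.inj hrq)]
        · have := hr (i + 1)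
          rw [hs i, hs (i + 1)] at this
          obtain ⟨s', hs', h⟩ := this
          change s (i + 1) ∈ M.step (s i) (w (i + 1))
          rwa [Sum.inl.inj (Option.some.inj h)]
      · rw [← infinite_succ_iff]
        refine hacc'.mono ?_
        rintro i (⟨q, hq, h⟩ | ⟨q, hq, h⟩)
        · rw [hs i] at h
          change s i ∈ M.accept
          rwa [Sum.inl.inj (Option.some.inj h)]
        · rw [hs i] at h
          cases Option.some.inj h
    · right
      have hsome : ∀ i, ∃ s, r (i + 1) = some (.inr s) := by
        intro i
        induction i with
        | zero => exact ⟨q, hrq⟩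
        | succ i ih =>
          obtain ⟨s, hs⟩ := ih
          have := hr (i + 1)
          rw [hs] at this
          obtain ⟨s', -, h⟩ := this
          exact ⟨s', h⟩
      choose s hs using hsome
      refine ⟨fun i => i.casesOn N.init s, ⟨rfl, ?_⟩, ?_⟩
      · rintro (_ | i)
        · rw [hs 0] at hrq
          change s 0 ∈ N.step N.init (w 0)
          rwa [Sum.inr.inj (Option.some.inj hrq)]
        · have := hr (i + 1)
          rw [hs i, hs (i + 1)] at this
          obtain ⟨s', hs', h⟩ := this
          change s (i + 1) ∈ N.step (s i) (w (i + 1))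
          rwa [Sum.inr.inj (Option.some.inj h)]
      · rw [← infinite_succ_iff]
        refine hacc'.mono ?_
        rintro i (⟨q, hq, h⟩ | ⟨q, hq, h⟩)
        · rw [hs i] at h
          cases Option.some.inj h
        · rw [hs i] at h
          change s i ∈ N.accept
          rwa [Sum.inr.inj (Option.some.inj h)]
  · rintro (⟨r, ⟨hr0, hr⟩, hacc⟩ | ⟨r, ⟨hr0, hr⟩, hacc⟩)
    · refine ⟨fun i => i.casesOn none fun i => some (.inl (r (i + 1))), ⟨rfl, ?_⟩, ?_⟩
      · rintro (_ | i)
        · exact Or.inl ⟨r 1, hr0 ▸ hr 0, rfl⟩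
        · exact ⟨r (i + 2), hr (i + 1), rfl⟩
      · rw [← infinite_succ_iff]
        exact (infinite_succ_iff.2 hacc).mono fun i hi => Or.inl ⟨r (i + 1), hi, rfl⟩
    · refine ⟨fun i => i.casesOn none fun i => some (.inr (r (i + 1))), ⟨rfl, ?_⟩, ?_⟩
      · rintro (_ | i)
        · exact Or.inr ⟨r 1, hr0 ▸ hr 0, rfl⟩
        · exact ⟨r (i + 2), hr (i + 1), rfl⟩
      · rw [← infinite_succ_iff]
        exact (infinite_succ_iff.2 hacc).mono fun i hi => Or.inr ⟨r (i + 1), hi, rfl⟩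

/-! ### The information flow assumption -/

/-- The construction is correct for every automaton that recognizes `φ` on the traces over the
outputs of the environment and of the process: all words that the projection feeds into the
self-composition consist of such traces. -/
theorem language_infoFlow (S : Architecture V) (φ : LTL V) (M : BuchiAutomaton (Set V) σ)
    (hM : ∀ π : Trace V, π.IsOver (S.Oe ∪ S.Op) → (π ∈ M.language ↔ φ.Sat π)) :
    (M.infoFlow S).language = pairWords (S.infoFlowAssumption φ) := by
  ext w
  have hdiff : (∃ i, (w i).1 ∩ S.Ip ≠ (w i).2 ∩ S.Ip) ↔
      Trace.proj (fun i => (w i).1) S.Ip ≠ Trace.proj (fun i => (w i).2) S.Ip :=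
    Function.ne_iff.symm
  have hOe : ∀ π : Trace V, (π.proj S.Oe).IsOver S.Oe := fun π i => Set.inter_subset_right
  have hover : ∀ π o : Trace V, o.IsOver S.Op → ((π.proj S.Oe).combine o).IsOver (S.Oe ∪ S.Op) :=
    fun π o ho i => Set.union_subset_union (hOe π i) (ho i)
  -- The guessed values are the only ones on `S.Op`, so that both components agree there.
  -- (As a plain equation, `simp` would see a permutation of `x` and `y` and not close the goal.)
  have hagree : ∀ x y o : Set V, (x ∩ S.Oe ∪ o) ∩ S.Op = (y ∩ S.Oe ∪ o) ∩ S.Op ↔ True := by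
    have hd : ∀ v ∈ S.Op, v ∉ S.Oe := fun v hv => Set.disjoint_left.1 S.disjoint_Op_Oe hv
    refine fun x y o => iff_true_intro ?_
    ext v
    have := hd v
    simp only [Set.mem_inter_iff, Set.mem_union]
    tauto
  rw [infoFlow, mem_language_union, mem_language_projectOut, mem_language_inputsDiffer, hdiff]
  simp only [mem_language_selfComp, hagree, implies_true, and_true]
  have hex : (∃ o : Trace V, o.IsOver S.Op ∧ (fun i => (w i).1 ∩ S.Oe ∪ o i) ∈ M.language ∧
      (fun i => (w i).2 ∩ S.Oe ∪ o i) ∈ M.language) ↔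
      (Trace.proj (fun i => (w i).1) S.Oe, Trace.proj (fun i => (w i).2) S.Oe) ∉
        S.distinguishability φ := by
    have h : ∀ π o : Trace V, o.IsOver S.Op → ((fun i => π i ∩ S.Oe ∪ o i) ∈ M.language ↔
        φ.Sat ((π.proj S.Oe).combine o)) := fun π o ho => hM _ (hover π o ho)
    simp only [Architecture.distinguishability, Set.mem_ofPred_eq, hOe, true_and, not_forall,
      not_not, exists_prop]
    exact exists_congr fun o => and_congr_right fun ho => and_congr (h _ o ho) (h _ o ho)
  rw [hex]
  exact imp_iff_not_or.symm

end BuchiAutomaton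

theorem LTL.length_pos {V : Type*} (φ : LTL V) : 0 < φ.length := by
  cases φ <;> simp [LTL.length]

/-- There is an absolute constant `c` such that, for every architecture and every LTL local
specification `φ` of process `p`: (i) some Büchi automaton with at most `2 ^ (c * |φ|)` states
recognizes the information flow assumption of `p`; (ii) it can be obtained from a Büchi automaton
`M` for `φ`, itself with at most `2 ^ (c * |φ|)` states, by self-composition, projection and union
with the two-state automaton for differing inputs; (iii) that construction is correct for every
automaton `M` for `φ`. -/
theorem theorem3 :
    ∃ c : ℕ, ∀ (V : Type*) (S : Architecture V) (φ : LTL V), S.IsLocalSpec φ →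
      (∃ (τ : Type) (_ : Fintype τ) (E : BuchiAutomaton (Set V × Set V) τ),
        E.language = pairWords (S.infoFlowAssumption φ) ∧
        Fintype.card τ ≤ 2 ^ (c * φ.length)) ∧
      (∃ (σ : Type) (_ : Fintype σ) (M : BuchiAutomaton (Set V) σ),
        M.language = {π | φ.Sat π} ∧
        Fintype.card σ ≤ 2 ^ (c * φ.length) ∧
        (M.infoFlow S).language = pairWords (S.infoFlowAssumption φ) ∧
        Fintype.card (Option ((σ × σ × Bool) ⊕ Bool)) ≤ 2 ^ (c * φ.length)) ∧
      (∀ (σ : Type) (_ : Fintype σ) (M : BuchiAutomaton (Set V) σ),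
        (∀ π : Trace V, π.IsOver (S.Oe ∪ S.Op) → (π ∈ M.language ↔ φ.Sat π)) →
        (M.infoFlow S).language = pairWords (S.infoFlowAssumption φ)) := by
  refine ⟨9, fun V S φ _ => ?_⟩
  obtain ⟨σ, _, M, hM, hσ⟩ := φ.exists_buchi
  have hflow := M.language_infoFlow S φ fun π _ => by rw [hM]; rfl
  have hn := φ.length_pos
  -- With `x = 2 ^ n ≥ 2` there are `N ≤ x ^ 2 + 1 ≤ x ^ 3` states, and `2 * N ^ 2 + 3 ≤ x ^ 9`.
  have hσ' : Fintype.card σ ≤ 2 ^ (3 * φ.length) := by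
    have h1 : 2 ^ (2 * φ.length) * 2 ≤ 2 ^ (3 * φ.length) := by
      rw [← pow_succ]
      exact Nat.pow_le_pow_right two_pos (by omega)
    have h2 : 1 ≤ 2 ^ (2 * φ.length) := Nat.one_le_two_pow
    omega
  have hcard : Fintype.card (Option ((σ × σ × Bool) ⊕ Bool)) ≤ 2 ^ (9 * φ.length) := by
    rw [Fintype.card_option, Fintype.card_sum, Fintype.card_prod, Fintype.card_prod,
      Fintype.card_bool]
    have h1 : Fintype.card σ * Fintype.card σ ≤ 2 ^ (6 * φ.length) := by
      rw [show 6 * φ.length = 3 * φ.length + 3 * φ.length by omega, pow_add]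
      exact Nat.mul_le_mul hσ' hσ'
    have h2 : 2 ^ (6 * φ.length) * 2 ^ 3 ≤ 2 ^ (9 * φ.length) := by
      rw [← pow_add]
      exact Nat.pow_le_pow_right two_pos (by omega)
    have h3 : 1 ≤ 2 ^ (6 * φ.length) := Nat.one_le_two_pow
    rw [← mul_assoc]
    omega
  exact ⟨⟨_, inferInstance, M.infoFlow S, hflow, hcard⟩,
    ⟨σ, inferInstance, M, hM, hσ'.trans (Nat.pow_le_pow_right two_pos (by omega)), hflow, hcard⟩,
    fun _ _ M' hM' => M'.language_infoFlow S φ hM'⟩
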